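/- A \emph{Heyting-Lewis algebra} is a Heyting algebra $A$ with a binary operation $\Rightarrow$ (strict implication, distinct from the Heyting implication $\to$) satisfying, for all $a,b,c\in A$: $(a\Rightarrow b)\wedge(a\Rightarrow c)=a\Rightarrow(b\wedge c)$; $(a\Rightarrow c)\wedge(b\Rightarrow c)=(a\vee b)\Rightarrow c$; $(a\Rightarrow b)\wedge(b\Rightarrow c)\le a\Rightarrow c$; $a\Rightarrow a=\top$. The category $\mathsf{HLAs}$ has these as objects and the Heyting homomorphisms preserving $\Rightarrow$ as morphisms. A \emph{general strict-implication frame} is a tuple $(X,\preceq,\sqsubset,P)$ where $(X,\preceq)$ is a poset (possibly empty), $\sqsubset$ is a binary relation on $X$ such that $x\preceq y\sqsubset z$ implies $x\sqsubset z$, and $P$ is a collection of $\preceq$-upsets containing $X$ and $\emptyset$ and closed under $\cap$, $\cup$ and the operations $$a\mathbin{\underline{\to}} b=\{x : \forall y\,(x\preceq y,\ y\in a \text{ imply } y\in b)\},\qquad a\mathbin{\underline{\Rightarrow}} b=\{x : \forall y\,(x\sqsubset y,\ y\in a\text{ imply } y\in b)\}.$$ It is \emph{descriptive} if moreover: (compactness)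 for all $\mathcal A\subseteq P$ and $\mathcal B\subseteq\{X\setminus a : a\in P\}$, if every finite subfamily of $\mathcal A\cup\mathcal B$ has non-empty intersection (the empty subfamily having intersection $X$), then $\bigcap(\mathcal A\cup\mathcal B)\neq\emptyset$; ($\preceq$-refinedness) if $x\not\preceq y$ then there is $a\in P$ with $x\in a$ and $y\notin a$; ($\sqsubset$-refinedness) if $x\not\sqsubset y$ then there are $a,b\in P$ with $x\in a\mathbin{\underline{\Rightarrow}}b$, $y\in a$ and $y\notin b$. The category $\mathsf{D\text{-}Frm}$ has the descriptive frames as objects; a morphism from $(X,\preceq,\sqsubset,P)$ to $(X',\preceq',\sqsubset',P')$ is a function $f:X\to X'$ such that for each pair $(R,R')\in\{(\preceq,\preceq'),(\sqsubset,\sqsubset')\}$, $xRy$ implies $f(x)R'f(y)$, and $f(x)R'z'$ implies that there is $z$ with $xRz$ and $f(z)=z'$, and such that $f^{-1}(a')\in P$ for all $a'\in P'$. For a descriptive frame $\mathfrak G=(X,\preceq,\sqsubset,P)$ let $\mathfrak G^*$ be $P$, ordered by inclusion, with Heyting implication $\underline{\to}$ and strict implication $\underline{\Rightarrow}$, and for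 a morphism $f$ let $f^*=f^{-1}$; this is a contravariant functor $(\cdot)^*:\mathsf{D\text{-}Frm}\to\mathsf{HLAs}$. For a Heyting-Lewis algebra $A$ let $A_*=(\mathrm{pf}A,\subseteq,\sqsubset,\tilde A)$, where $\mathrm{pf}A$ is the set of prime filters of $A$, $\mathfrak p\sqsubset\mathfrak q$ iff for all $a,b\in A$, $a\Rightarrow b\in\mathfrak p$ and $a\in\mathfrak q$ imply $b\in\mathfrak q$, and $\tilde A=\{\tilde a : a\in A\}$ with $\tilde a=\{\mathfrak p\in\mathrm{pf}A : a\in\mathfrak p\}$; for a morphism $h$ let $h_*=h^{-1}$. \textbf{Theorem.} For every Heyting-Lewis algebra $A$ and all $a,b\in A$, $\widetilde{a\Rightarrow b}=\tilde a\mathbin{\underline{\Rightarrow}}\tilde b$. Moreover, $A_*$ is a descriptive frame for every $A$, $h_*$ is a morphism of descriptive frames for every morphism $h$ of Heyting-Lewis algebras, so that $(\cdot)_*:\mathsf{HLAs}\to\mathsf{D\text{-}Frm}$ is a contravariant functor, and the functors $(\cdot)_*$ and $(\cdot)^*$ form a dual equivalence $\mathsf{HLAs}\equiv^{op}\mathsf{D\text{-}Frm}$.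 -/

import Mathlib

open CategoryTheory Opposite

universe u

/-! ### Heyting-Lewis algebras -/

/-- A Heyting-Lewis algebra: a Heyting algebra with a binary operator `⥽` (strict implication)
that makes its lattice reduct a weak Heyting algebra. -/
class HeytingLewisAlgebra (A : Type u) extends HeytingAlgebra A where
  /-- Strict implication. -/
  sto : A → A → A
  sto_inf_sto : ∀ a b c : A, sto a b ⊓ sto a c = sto a (b ⊓ c)
  sto_sup : ∀ a b c : A, sto a c ⊓ sto b c = sto (a ⊔ b) c
  sto_trans : ∀ a b c : A, sto a b ⊓ sto b c ≤ sto a c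
  sto_self : ∀ a : A, sto a a = ⊤

infixr:60 " ⥽ " => HeytingLewisAlgebra.sto

/-- The objects of the category of Heyting-Lewis algebras. -/
structure HLAlg : Type (u + 1) where
  carrier : Type u
  [str : HeytingLewisAlgebra carrier]

namespace HLAlg

instance : CoeSort HLAlg.{u} (Type u) := ⟨HLAlg.carrier⟩

attribute [instance] HLAlg.str

/-- Morphisms of Heyting-Lewis algebras: Heyting homomorphisms that preserve `⥽`. -/
@[ext]
structure Hom (A B : HLAlg.{u}) where
  toHeytingHom : HeytingHom A B
  map_sto : ∀ a b : A, toHeytingHom (a ⥽ b) = toHeytingHom a ⥽ toHeytingHom b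

instance : Category HLAlg.{u} where
  Hom A B := Hom A B
  id A := ⟨HeytingHom.id A, fun _ _ => rfl⟩
  comp f g := ⟨g.toHeytingHom.comp f.toHeytingHom, fun a b => by
    simp [f.map_sto, g.map_sto]⟩

end HLAlg

/-! ### General and descriptive strict-implication frames -/

/-- The raw data `(X, ≼, ⊏, P)` of a general frame: a poset, a binary relation on it and a
collection of subsets (the admissible ones). The axioms are in `IsGeneral` and `IsDescriptive`. -/
structure FrameData : Type (u + 1) where
  carrier : Type u
  [order : PartialOrder carrier]
  rel : carrier → carrier → Prop
  admissible : Set (Set carrier)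

namespace FrameData

instance : CoeSort FrameData.{u} (Type u) := ⟨FrameData.carrier⟩

attribute [instance] FrameData.order

/-- The Heyting implication of sets of states, computed along `≼`. -/
def impSet (F : FrameData.{u}) (a b : Set F) : Set F :=
  {x | ∀ y, x ≤ y → y ∈ a → y ∈ b}

/-- The strict implication of sets of states, computed along `⊏`. -/
def stoSet (F : FrameData.{u}) (a b : Set F) : Set F :=
  {x | ∀ y, F.rel x y → y ∈ a → y ∈ b}

/-- General strict-implication frames. -/
structure IsGeneral (F : FrameData.{u}) : Prop where
  rel_of_le_of_rel : ∀ x y z : F, x ≤ y → F.rel y z → F.rel x z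
  isUpperSet : ∀ a ∈ F.admissible, IsUpperSet a
  univ_mem : Set.univ ∈ F.admissible
  empty_mem : ∅ ∈ F.admissible
  inter_mem : ∀ a ∈ F.admissible, ∀ b ∈ F.admissible, a ∩ b ∈ F.admissible
  union_mem : ∀ a ∈ F.admissible, ∀ b ∈ F.admissible, a ∪ b ∈ F.admissible
  impSet_mem : ∀ a ∈ F.admissible, ∀ b ∈ F.admissible, F.impSet a b ∈ F.admissible
  stoSet_mem : ∀ a ∈ F.admissible, ∀ b ∈ F.admissible, F.stoSet a b ∈ F.admissible

/-- Descriptive strict-implication frames. In `compact`, the finite intersection property includes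
the empty subfamily, whose intersection is the whole set of states; this matters only for the
empty frame, which is the dual of the one-element algebra. -/
structure IsDescriptive (F : FrameData.{u}) : Prop extends IsGeneral F where
  compact : ∀ 𝒜 ⊆ F.admissible, ∀ ℬ ⊆ {c : Set F | ∃ a ∈ F.admissible, c = aᶜ},
    (∀ 𝒮 ⊆ 𝒜 ∪ ℬ, 𝒮.Finite → (⋂₀ 𝒮).Nonempty) → (⋂₀ (𝒜 ∪ ℬ)).Nonempty
  le_refined : ∀ x y : F, ¬ x ≤ y → ∃ a ∈ F.admissible, x ∈ a ∧ y ∉ a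
  rel_refined : ∀ x y : F, ¬ F.rel x y →
    ∃ a ∈ F.admissible, ∃ b ∈ F.admissible, x ∈ F.stoSet a b ∧ y ∈ a ∧ y ∉ b

/-- Morphisms of general frames: functions that are bounded for both relations and for which
preimages of admissible sets are admissible. -/
structure IsMorphism (F G : FrameData.{u}) (f : F → G) : Prop where
  map_le : ∀ x y : F, x ≤ y → f x ≤ f y
  exists_le : ∀ (x : F) (z' : G), f x ≤ z' → ∃ z : F, x ≤ z ∧ f z = z'
  map_rel : ∀ x y : F, F.rel x y → G.rel (f x) (f y)
  exists_rel : ∀ (x : F) (z' : G), G.rel (f x) z' → ∃ z : F, F.rel x z ∧ f z = z'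
  preimage_mem : ∀ a ∈ G.admissible, f ⁻¹' a ∈ F.admissible

theorem IsMorphism.id (F : FrameData.{u}) : IsMorphism F F _root_.id where
  map_le _ _ h := h
  exists_le _ z h := ⟨z, h, rfl⟩
  map_rel _ _ h := h
  exists_rel _ z h := ⟨z, h, rfl⟩
  preimage_mem _ h := h

theorem IsMorphism.comp {F G H : FrameData.{u}} {g : G → H} {f : F → G}
    (hg : IsMorphism G H g) (hf : IsMorphism F G f) : IsMorphism F H (g ∘ f) where
  map_le _ _ h := hg.map_le _ _ (hf.map_le _ _ h)
  exists_le x z h := by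
    obtain ⟨y, hy, rfl⟩ := hg.exists_le _ z h
    obtain ⟨w, hw, rfl⟩ := hf.exists_le _ y hy
    exact ⟨w, hw, rfl⟩
  map_rel _ _ h := hg.map_rel _ _ (hf.map_rel _ _ h)
  exists_rel x z h := by
    obtain ⟨y, hy, rfl⟩ := hg.exists_rel _ z h
    obtain ⟨w, hw, rfl⟩ := hf.exists_rel _ y hy
    exact ⟨w, hw, rfl⟩
  preimage_mem _ h := hf.preimage_mem _ (hg.preimage_mem _ h)

/-- The admissible sets of a general frame, ordered by inclusion, form a Heyting-Lewis algebra
under union, intersection and the two set-theoretic implications. -/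
abbrev algebra (F : FrameData.{u}) (hF : F.IsGeneral) : HeytingLewisAlgebra F.admissible where
  le a b := (a : Set F) ⊆ b
  le_refl _ := subset_rfl
  le_trans _ _ _ h h' := h.trans h'
  le_antisymm _ _ h h' := Subtype.ext (h.antisymm h')
  sup a b := ⟨a ∪ b, hF.union_mem _ a.2 _ b.2⟩
  le_sup_left _ _ := Set.subset_union_left
  le_sup_right _ _ := Set.subset_union_right
  sup_le _ _ _ h h' := Set.union_subset h h'
  inf a b := ⟨a ∩ b, hF.inter_mem _ a.2 _ b.2⟩
  inf_le_left _ _ := Set.inter_subset_left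
  inf_le_right _ _ := Set.inter_subset_right
  le_inf _ _ _ h h' := Set.subset_inter h h'
  top := ⟨Set.univ, hF.univ_mem⟩
  le_top _ := Set.subset_univ _
  bot := ⟨∅, hF.empty_mem⟩
  bot_le _ := Set.empty_subset _
  himp a b := ⟨F.impSet a b, hF.impSet_mem _ a.2 _ b.2⟩
  le_himp_iff a b c := by
    constructor
    · rintro h x ⟨hxa, hxb⟩
      exact h hxa x le_rfl hxb
    · intro h x hx y hxy hy
      exact h ⟨hF.isUpperSet _ a.2 hxy hx, hy⟩
  compl a := ⟨F.impSet a ∅, hF.impSet_mem _ a.2 _ hF.empty_mem⟩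
  himp_bot _ := rfl
  sto a b := ⟨F.stoSet a b, hF.stoSet_mem _ a.2 _ b.2⟩
  sto_inf_sto a b c := Subtype.ext <| Set.ext fun _ =>
    ⟨fun h y hy hya => ⟨h.1 y hy hya, h.2 y hy hya⟩,
      fun h => ⟨fun y hy hya => (h y hy hya).1, fun y hy hya => (h y hy hya).2⟩⟩
  sto_sup a b c := Subtype.ext <| Set.ext fun _ =>
    ⟨fun h y hy hyab => hyab.elim (h.1 y hy) (h.2 y hy),
      fun h => ⟨fun y hy hya => h y hy (Or.inl hya), fun y hy hyb => h y hy (Or.inr hyb)⟩⟩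
  sto_trans a b c := fun _ h y hy hya => h.2 y hy (h.1 y hy hya)
  sto_self a := Subtype.ext <| Set.eq_univ_of_forall fun _ _ _ h => h

end FrameData

/-- The objects of the category of descriptive strict-implication frames. -/
structure DFrm : Type (u + 1) where
  data : FrameData.{u}
  isDescriptive : data.IsDescriptive

namespace DFrm

/-- Morphisms of descriptive frames: all morphisms of general frames between them. -/
@[ext]
structure Hom (F G : DFrm.{u}) where
  toFun : F.data → G.data
  isMorphism : FrameData.IsMorphism F.data G.data toFun

instance : Category DFrm.{u} where
  Hom F G := Hom F G
  id F := ⟨id, .id F.data⟩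
  comp f g := ⟨g.toFun ∘ f.toFun, g.isMorphism.comp f.isMorphism⟩

end DFrm

/-! ### From frames to algebras -/

/-- The Heyting-Lewis algebra of admissible sets of a descriptive frame. -/
def DFrm.upperStarObj (F : DFrm.{u}) : HLAlg.{u} where
  carrier := F.data.admissible
  str := F.data.algebra F.isDescriptive.toIsGeneral

/-- A frame morphism acts on admissible sets by preimage. -/
def DFrm.upperStarMap {F G : DFrm.{u}} (f : F ⟶ G) : G.upperStarObj ⟶ F.upperStarObj where
  toHeytingHom :=
    { toFun := fun (a : G.data.admissible) => ⟨f.toFun ⁻¹' a.1, f.isMorphism.preimage_mem _ a.2⟩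
      map_sup' := fun _ _ => rfl
      map_inf' := fun _ _ => rfl
      map_bot' := rfl
      map_himp' := fun (a b : G.data.admissible) => Subtype.ext <| Set.ext fun x => by
        constructor
        · intro h y hxy hy
          exact h _ (f.isMorphism.map_le _ _ hxy) hy
        · intro h z' hz' hza
          obtain ⟨z, hz, rfl⟩ := f.isMorphism.exists_le _ _ hz'
          exact h z hz hza }
  map_sto a b := Subtype.ext <| Set.ext fun x => by
    constructor
    · intro h y hxy hy
      exact h _ (f.isMorphism.map_rel _ _ hxy) hy
    · intro h z' hz' hza
      obtain ⟨z, hz, rfl⟩ := f.isMorphism.exists_rel _ _ hz'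
      exact h z hz hza

/-- The contravariant functor `(·)^*` from descriptive frames to Heyting-Lewis algebras. -/
def upperStar : DFrm.{u}ᵒᵖ ⥤ HLAlg.{u} where
  obj F := F.unop.upperStarObj
  map f := DFrm.upperStarMap f.unop
  map_id _ := rfl
  map_comp _ _ := rfl

/-! ### From algebras to frames -/

namespace HLAlg

/-- The prime filters of a Heyting-Lewis algebra, ordered by inclusion. -/
abbrev PrimeFilter (A : HLAlg.{u}) : Type u := {p : Order.PFilter A // p.IsPrime}

/-- The set of prime filters that contain `a`. -/
def tilde (A : HLAlg.{u}) (a : A) : Set A.PrimeFilter := {p | a ∈ p.1}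

/-- The data `(pf A, ⊆, ⊏, Ã)` dual to a Heyting-Lewis algebra. -/
abbrev lowerStarData (A : HLAlg.{u}) : FrameData.{u} where
  carrier := A.PrimeFilter
  rel p q := ∀ a b : A, a ⥽ b ∈ p.1 → a ∈ q.1 → b ∈ q.1
  admissible := Set.range A.tilde

/-- The preimage of a prime filter under a morphism of Heyting-Lewis algebras. -/
def comapPrimeFilter {A B : HLAlg.{u}} (h : A ⟶ B) (p : B.PrimeFilter) : A.PrimeFilter :=
  ⟨Order.IsPFilter.toPFilter (F := {a : A | h.toHeytingHom a ∈ p.1}) <| .of_def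
      ⟨⊤, by simp⟩
      (fun x hx y hy => ⟨x ⊓ y, by
        simpa using Order.PFilter.inf_mem hx hy, inf_le_left, inf_le_right⟩)
      (fun hxy hx => Order.PFilter.mem_of_le (OrderHomClass.mono h.toHeytingHom hxy) hx), by
    refine ⟨fun x y hyx (hx : h.toHeytingHom x ∉ p.1) (hy : h.toHeytingHom y ∈ p.1) =>
      hx (Order.PFilter.mem_of_le (OrderHomClass.mono h.toHeytingHom hyx) hy), ⟨⊥, ?_⟩, ?_⟩
    · intro (hb : h.toHeytingHom ⊥ ∈ p.1)
      rw [map_bot] at hb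
      obtain ⟨x, hx⟩ := p.2.compl_ideal.Nonempty
      exact hx (Order.PFilter.mem_of_le bot_le hb)
    · intro x hx y hy
      refine ⟨x ⊔ y, ?_, le_sup_left, le_sup_right⟩
      intro (hxy : h.toHeytingHom (x ⊔ y) ∈ p.1)
      obtain ⟨z, hz, hxz, hyz⟩ := p.2.compl_ideal.Directed _ hx _ hy
      rw [map_sup] at hxy
      exact hz (Order.PFilter.mem_of_le (sup_le hxz hyz) hxy)⟩

theorem mem_comapPrimeFilter {A B : HLAlg.{u}} (h : A ⟶ B) (p : B.PrimeFilter) (a : A) :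
    a ∈ (comapPrimeFilter h p).1 ↔ h.toHeytingHom a ∈ p.1 := Iff.rfl

end HLAlg

/-- The contravariant functor `(·)_*` from Heyting-Lewis algebras to descriptive frames. Its two
arguments say that it is well defined on objects and on morphisms. -/
def lowerStar
    (hobj : ∀ A : HLAlg.{u}, A.lowerStarData.IsDescriptive)
    (hmap : ∀ (A B : HLAlg.{u}) (h : A ⟶ B),
      FrameData.IsMorphism B.lowerStarData A.lowerStarData (HLAlg.comapPrimeFilter h)) :
    HLAlg.{u} ⥤ DFrm.{u}ᵒᵖ where
  obj A := op ⟨A.lowerStarData, hobj A⟩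
  map {A B} h := Quiver.Hom.op
    (⟨HLAlg.comapPrimeFilter h, hmap A B h⟩ :
      DFrm.Hom ⟨B.lowerStarData, hobj B⟩ ⟨A.lowerStarData, hobj A⟩)
  map_id _ := rfl
  map_comp _ _ := rfl

/-! The four axioms on `⥽` say that, for a fixed filter `p`, the relation "`a ⥽ b ∈ p`" behaves like
an entailment relation: it extends `≤`, is transitive, and respects binary meets on the right and
joins on the left. The `⊏`-successors of `p` are exactly the prime filters closed under this
entailment. So a single Zorn argument for an arbitrary entailment `R`,
`exists_isPrime_pfilter_closed`, serves throughout, with three choices of `R`.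

Taking `R` to be `≤` separates elements by prime filters and gives compactness. Taking `a ⇨ b ∈ p`,
whose closed filters extend `p`, or `a ⥽ b ∈ p`, gives the corresponding implication under `a ↦ ã`
(separate `a` from `b`) and the back condition for `h_*` (separate `h[q]` from `h[A ∖ q]`).

In the other direction, a state is sent to the prime filter of admissible sets containing it.
Refinedness makes this map an embedding for both relations, and compactness makes it surjective.
Both double-dual maps are thus isomorphisms, and their naturality is definitional. -/

/-! ### Prime filters -/

section PrimeFilters

variable {A : Type u} [DistribLattice A]

/-- The prime filter theorem relative to an entailment relation `R` that extends the order: a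
meet-closed set `S` none of whose elements entails an element of the join-closed set `T` extends to
an `R`-closed prime filter that avoids `T`. -/
theorem exists_isPrime_pfilter_closed {R : A → A → Prop}
    (hle : ∀ a b, a ≤ b → R a b) (htrans : ∀ a b c, R a b → R b c → R a c)
    (hinf : ∀ a b c, R a b → R a c → R a (b ⊓ c)) (hsup : ∀ a b c, R a c → R b c → R (a ⊔ b) c)
    {S T : Set A} (hS : S.Nonempty) (hS' : InfClosed S) (hT : T.Nonempty) (hT' : SupClosed T)
    (hST : ∀ s ∈ S, ∀ t ∈ T, ¬ R s t) :
    ∃ q : Order.PFilter A, q.IsPrime ∧ (∀ s ∈ S, s ∈ q) ∧ (∀ t ∈ T, t ∉ q) ∧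
      ∀ a b, R a b → a ∈ q → b ∈ q := by
  let Z : Set (Set A) := {F | InfClosed F ∧ (∀ a b, R a b → a ∈ F → b ∈ F) ∧ ∀ t ∈ T, t ∉ F}
  -- Membership in `Z` asks for neither nonemptiness nor primeness: the former comes from containing
  -- `S`, the latter from maximality.
  have generated (U : Set A) (hU : InfClosed U) (hUT : ∀ s ∈ U, ∀ t ∈ T, ¬ R s t) :
      {z | ∃ s ∈ U, R s z} ∈ Z := by
    refine ⟨?_, ?_, ?_⟩
    · rintro x ⟨s, hs, hsx⟩ y ⟨s', hs', hsy⟩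
      exact ⟨s ⊓ s', hU hs hs', hinf _ _ _ (htrans _ _ _ (hle _ _ inf_le_left) hsx)
        (htrans _ _ _ (hle _ _ inf_le_right) hsy)⟩
    · rintro a b hab ⟨s, hs, hsa⟩
      exact ⟨s, hs, htrans _ _ _ hsa hab⟩
    · rintro t ht ⟨s, hs, hst⟩
      exact hUT s hs t ht hst
  obtain ⟨F, hSF, hF⟩ := zorn_subset_nonempty Z
    (fun c hc hchain hne => ⟨⋃₀ c, ⟨by
        rintro x ⟨F, hF, hx⟩ y ⟨G, hG, hy⟩
        rcases hchain.total hF hG with h | h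
        · exact ⟨G, hG, (hc hG).1 (h hx) hy⟩
        · exact ⟨F, hF, (hc hF).1 hx (h hy)⟩, by
        rintro a b hab ⟨F, hF, ha⟩
        exact ⟨F, hF, (hc hF).2.1 a b hab ha⟩, by
        rintro t ht ⟨F, hF, htF⟩
        exact (hc hF).2.2 t ht htF⟩, fun _ => Set.subset_sUnion_of_mem⟩)
    _ (generated S hS' hST)
  obtain ⟨hFinf, hFR, hFT⟩ := hF.prop
  have hSF' : ∀ s ∈ S, s ∈ F := fun s hs => hSF ⟨s, hs, hle _ _ le_rfl⟩
  -- Maximality: otherwise the `R`-closure of the elements `f ⊓ x` with `f ∈ F` would lie in `Z` and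
  -- contain both `F` and `x`.
  have extend (x : A) (hx : x ∉ F) : ∃ f ∈ F, ∃ t ∈ T, R (f ⊓ x) t := by
    by_contra! hcon
    have hU : InfClosed {z | ∃ f ∈ F, z = f ⊓ x} := by
      rintro _ ⟨f, hf, rfl⟩ _ ⟨g, hg, rfl⟩
      exact ⟨f ⊓ g, hFinf hf hg, by rw [inf_inf_inf_comm, inf_idem]⟩
    have hmem := generated _ hU (by rintro _ ⟨f, hf, rfl⟩ t ht; exact hcon f hf t ht)
    obtain ⟨s, hs⟩ := hS
    exact hx (hF.le_of_ge hmem (fun f hf => ⟨f ⊓ x, ⟨f, hf, rfl⟩, hle _ _ inf_le_left⟩)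
      ⟨s ⊓ x, ⟨s, hSF' s hs, rfl⟩, hle _ _ inf_le_right⟩)
  have hmono {a b : A} (hab : a ≤ b) (ha : a ∈ F) : b ∈ F := hFR a b (hle _ _ hab) ha
  have hFilter : Order.IsPFilter F := .of_def (hS.imp hSF')
    (fun x hx y hy => ⟨x ⊓ y, hFinf hx hy, inf_le_left, inf_le_right⟩) hmono
  refine ⟨hFilter.toPFilter, ⟨⟨?_, hT.imp hFT, ?_⟩⟩, hSF', hFT, hFR⟩
  · exact fun x y hyx hx hy => hx (hmono hyx hy)
  · refine fun x hx y hy => ⟨x ⊔ y, fun hxy => ?_, le_sup_left, le_sup_right⟩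
    obtain ⟨f, hf, t, ht, hft⟩ := extend x hx
    obtain ⟨g, hg, r, hr, hgr⟩ := extend y hy
    -- From `R (f ⊓ x) t` and `R (g ⊓ y) r`, distributivity yields `R ((f ⊓ g) ⊓ (x ⊔ y)) (t ⊔ r)`,
    -- so `x ⊔ y ∈ F` would put an element of `T` in `F`.
    refine hFT (t ⊔ r) (hT' ht hr) (hFR _ _ ?_ (hFinf (hFinf hf hg) hxy))
    rw [inf_sup_left]
    exact hsup _ _ _
      (htrans _ _ _ (hle _ _ (inf_le_inf_right x inf_le_left))
        (htrans _ _ _ hft (hle _ _ le_sup_left)))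
      (htrans _ _ _ (hle _ _ (inf_le_inf_right y inf_le_right))
        (htrans _ _ _ hgr (hle _ _ le_sup_right)))

theorem Order.PFilter.IsPrime.bot_notMem [BoundedOrder A] {p : Order.PFilter A} (hp : p.IsPrime) : ⊥ ∉ p := by
  intro hb
  obtain ⟨x, hx⟩ := hp.compl_ideal.Nonempty
  exact hx (Order.PFilter.mem_of_le bot_le hb)

theorem Order.PFilter.IsPrime.sup_mem_iff {p : Order.PFilter A} (hp : p.IsPrime) {a b : A} :
    a ⊔ b ∈ p ↔ a ∈ p ∨ b ∈ p := by
  refine ⟨fun h => ?_, fun h => h.elim (Order.PFilter.mem_of_le le_sup_left)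
    (Order.PFilter.mem_of_le le_sup_right)⟩
  by_contra! hcon
  obtain ⟨z, hz, haz, hbz⟩ := hp.compl_ideal.Directed _ hcon.1 _ hcon.2
  exact hz (Order.PFilter.mem_of_le (sup_le haz hbz) h)

end PrimeFilters

/-! ### Strict implication and prime filters -/

namespace HeytingLewisAlgebra

variable {A : Type u} [HeytingLewisAlgebra A]

theorem sto_eq_top_of_le {a b : A} (h : a ≤ b) : a ⥽ b = ⊤ := by
  have := sto_inf_sto a a b
  rw [inf_eq_left.mpr h, sto_self, top_inf_eq] at this
  exact this

/-- The prime filter theorem for the strict implications that hold at a filter `p`. -/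
theorem exists_isPrime_pfilter_sto (p : Order.PFilter A)
    {S T : Set A} (hS : S.Nonempty) (hS' : InfClosed S) (hT : T.Nonempty) (hT' : SupClosed T)
    (hST : ∀ s ∈ S, ∀ t ∈ T, s ⥽ t ∉ p) :
    ∃ q : Order.PFilter A, q.IsPrime ∧ (∀ s ∈ S, s ∈ q) ∧ (∀ t ∈ T, t ∉ q) ∧
      ∀ a b, a ⥽ b ∈ p → a ∈ q → b ∈ q := by
  refine exists_isPrime_pfilter_closed (R := fun a b => a ⥽ b ∈ p) ?_ ?_ ?_ ?_ hS hS' hT hT' hST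
  · intro a b h
    rw [sto_eq_top_of_le h]
    exact Order.PFilter.top_mem
  · exact fun a b c h h' => Order.PFilter.mem_of_le (sto_trans a b c) (Order.PFilter.inf_mem h h')
  · exact fun a b c h h' => sto_inf_sto a b c ▸ Order.PFilter.inf_mem h h'
  · exact fun a b c h h' => sto_sup a b c ▸ Order.PFilter.inf_mem h h'

end HeytingLewisAlgebra

/-- The prime filter theorem for the Heyting implications that hold at a filter `p`. -/
theorem exists_isPrime_pfilter_himp {A : Type u} [HeytingAlgebra A] (p : Order.PFilter A)
    {S T : Set A} (hS : S.Nonempty) (hS' : InfClosed S) (hT : T.Nonempty) (hT' : SupClosed T)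
    (hST : ∀ s ∈ S, ∀ t ∈ T, s ⇨ t ∉ p) :
    ∃ q : Order.PFilter A, q.IsPrime ∧ (∀ s ∈ S, s ∈ q) ∧ (∀ t ∈ T, t ∉ q) ∧ p ≤ q := by
  obtain ⟨q, hq, hSq, hTq, hpq⟩ :=
    exists_isPrime_pfilter_closed (R := fun a b => a ⇨ b ∈ p)
      (fun a b h => by rw [himp_eq_top_iff.mpr h]; exact Order.PFilter.top_mem)
      (fun a b c h h' => Order.PFilter.mem_of_le (himp_triangle a b c)
        (Order.PFilter.inf_mem h h'))
      (fun a b c h h' => by rw [himp_inf_distrib]; exact Order.PFilter.inf_mem h h')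
      (fun a b c h h' => by rw [sup_himp_distrib]; exact Order.PFilter.inf_mem h h')
      hS hS' hT hT' hST
  -- Since `⊤ ⇨ b = b`, closure under the entailment applied to `⊤` says that `q` contains `p`.
  exact ⟨q, hq, hSq, hTq, fun b hb => hpq ⊤ b (by simpa using hb) Order.PFilter.top_mem⟩

/-! ### The dual frame of an algebra -/

namespace HLAlg

variable (A : HLAlg.{u})

theorem tilde_sto (a b : A) :
    A.tilde (a ⥽ b) = A.lowerStarData.stoSet (A.tilde a) (A.tilde b) := by
  ext p
  refine ⟨fun h q hpq ha => hpq a b h ha, fun h => ?_⟩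
  by_contra hab
  -- If `a ⥽ b ∉ p`, separating `a` from `b` produces a `⊏`-successor of `p` that refutes membership
  -- in the right-hand side.
  obtain ⟨q, hq, ha, hb, hpq⟩ := HeytingLewisAlgebra.exists_isPrime_pfilter_sto p.1
    (Set.singleton_nonempty a) infClosed_singleton (Set.singleton_nonempty b) supClosed_singleton
    (by rintro _ rfl _ rfl; exact hab)
  exact hb b rfl (h ⟨q, hq⟩ hpq (ha a rfl))

theorem tilde_himp (a b : A) :
    A.tilde (a ⇨ b) = A.lowerStarData.impSet (A.tilde a) (A.tilde b) := by
  ext p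
  refine ⟨fun h q hpq ha => Order.PFilter.mem_of_le inf_himp_le
    (Order.PFilter.inf_mem ha (hpq h)), fun h => ?_⟩
  by_contra hab
  obtain ⟨q, hq, ha, hb, hpq⟩ := exists_isPrime_pfilter_himp p.1
    (Set.singleton_nonempty a) infClosed_singleton (Set.singleton_nonempty b) supClosed_singleton
    (by rintro _ rfl _ rfl; exact hab)
  exact hb b rfl (h ⟨q, hq⟩ hpq (ha a rfl))

theorem tilde_top : A.tilde ⊤ = Set.univ := Set.eq_univ_of_forall fun _ => Order.PFilter.top_mem

theorem tilde_bot : A.tilde ⊥ = ∅ := Set.eq_empty_of_forall_notMem fun p => p.2.bot_notMem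

theorem tilde_inf (a b : A) : A.tilde (a ⊓ b) = A.tilde a ∩ A.tilde b :=
  Set.ext fun _ => ⟨fun h => ⟨Order.PFilter.mem_of_le inf_le_left h,
    Order.PFilter.mem_of_le inf_le_right h⟩, fun h => Order.PFilter.inf_mem h.1 h.2⟩

theorem tilde_sup (a b : A) : A.tilde (a ⊔ b) = A.tilde a ∪ A.tilde b :=
  Set.ext fun p => p.2.sup_mem_iff

theorem mem_tilde_finset_inf (s : Finset A) (p : A.PrimeFilter) :
    p ∈ A.tilde (s.inf id) ↔ ∀ a ∈ s, p ∈ A.tilde a := by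
  classical
  induction s using Finset.induction_on with
  | empty => simp [tilde_top]
  | insert a s _ ih => simp [tilde_inf, ih]

theorem mem_tilde_finset_sup (s : Finset A) (p : A.PrimeFilter) :
    p ∈ A.tilde (s.sup id) ↔ ∃ a ∈ s, p ∈ A.tilde a := by
  classical
  induction s using Finset.induction_on with
  | empty => simp [tilde_bot]
  | insert a s _ ih => simp [tilde_sup, ih]

theorem tilde_injective : Function.Injective A.tilde := by
  have key (a b : A) (h : A.tilde a ⊆ A.tilde b) : a ≤ b := by
    by_contra hab
    obtain ⟨q, hq, ha, hb, -⟩ := exists_isPrime_pfilter_closed (A := A) (R := (· ≤ ·))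
      (fun _ _ => id) (fun _ _ _ => le_trans) (fun _ _ _ => le_inf) (fun _ _ _ => sup_le)
      (Set.singleton_nonempty a) infClosed_singleton (Set.singleton_nonempty b)
      supClosed_singleton (by rintro _ rfl _ rfl; exact hab)
    exact hb b rfl (h (show (⟨q, hq⟩ : A.PrimeFilter) ∈ A.tilde a from ha a rfl))
  exact fun a b h => le_antisymm (key a b h.le) (key b a h.ge)

theorem lowerStarData_isGeneral : A.lowerStarData.IsGeneral where
  rel_of_le_of_rel _ _ _ hxy hyz a b hab ha := hyz a b (hxy hab) ha
  isUpperSet := by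
    rintro _ ⟨a, rfl⟩ p q hpq hp
    exact hpq hp
  univ_mem := ⟨⊤, A.tilde_top⟩
  empty_mem := ⟨⊥, A.tilde_bot⟩
  inter_mem := by
    rintro _ ⟨a, rfl⟩ _ ⟨b, rfl⟩
    exact ⟨_, A.tilde_inf a b⟩
  union_mem := by
    rintro _ ⟨a, rfl⟩ _ ⟨b, rfl⟩
    exact ⟨_, A.tilde_sup a b⟩
  impSet_mem := by
    rintro _ ⟨a, rfl⟩ _ ⟨b, rfl⟩
    exact ⟨_, A.tilde_himp a b⟩
  stoSet_mem := by
    rintro _ ⟨a, rfl⟩ _ ⟨b, rfl⟩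
    exact ⟨_, A.tilde_sto a b⟩

/-- Separate the finite meets of elements `a` with `ã ∈ 𝒜` from the finite joins of elements `b`
with complement of `b̃` in `ℬ`. If such a meet lay below such a join, a prime filter in the
corresponding finite intersection would contain the join, hence one of the excluded `b`. -/
theorem lowerStarData_compact (𝒜 : Set (Set A.PrimeFilter)) (h𝒜 : 𝒜 ⊆ Set.range A.tilde)
    (ℬ : Set (Set A.PrimeFilter)) (hℬ : ℬ ⊆ {c | ∃ a ∈ Set.range A.tilde, c = aᶜ})
    (hfip : ∀ 𝒮 ⊆ 𝒜 ∪ ℬ, 𝒮.Finite → (⋂₀ 𝒮).Nonempty) : (⋂₀ (𝒜 ∪ ℬ)).Nonempty := by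
  classical
  obtain ⟨q, hq, hS, hT, -⟩ := exists_isPrime_pfilter_closed (A := A) (R := (· ≤ ·))
    (fun _ _ => id) (fun _ _ _ => le_trans) (fun _ _ _ => le_inf) (fun _ _ _ => sup_le)
    (S := {z | ∃ s : Finset A, (∀ a ∈ s, A.tilde a ∈ 𝒜) ∧ z = s.inf id})
    (T := {z | ∃ t : Finset A, (∀ a ∈ t, (A.tilde a)ᶜ ∈ ℬ) ∧ z = t.sup id})
    -- The empty meet `⊤` and, below, the empty join `⊥` keep both sets nonempty even when `𝒜` or
    -- `ℬ` is empty.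
    ⟨_, ∅, by simp, rfl⟩
    (by
      rintro _ ⟨s, hs, rfl⟩ _ ⟨s', hs', rfl⟩
      refine ⟨s ∪ s', fun a ha => ?_, Finset.inf_union.symm⟩
      exact (Finset.mem_union.mp ha).elim (hs a) (hs' a))
    ⟨_, ∅, by simp, rfl⟩
    (by
      rintro _ ⟨s, hs, rfl⟩ _ ⟨s', hs', rfl⟩
      refine ⟨s ∪ s', fun a ha => ?_, Finset.sup_union.symm⟩
      exact (Finset.mem_union.mp ha).elim (hs a) (hs' a))
    (by
      rintro _ ⟨s, hs, rfl⟩ _ ⟨t, ht, rfl⟩ hst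
      obtain ⟨p, hp⟩ := hfip (A.tilde '' s ∪ (fun a => (A.tilde a)ᶜ) '' t)
        (by
          rintro _ (⟨a, ha, rfl⟩ | ⟨a, ha, rfl⟩)
          · exact Or.inl (hs a ha)
          · exact Or.inr (ht a ha))
        ((s.finite_toSet.image _).union (t.finite_toSet.image _))
      have hps : p ∈ A.tilde (s.inf id) :=
        (A.mem_tilde_finset_inf s p).mpr fun a ha => hp _ (Or.inl ⟨a, ha, rfl⟩)
      obtain ⟨b, hb, hpb⟩ := (A.mem_tilde_finset_sup t p).mp (Order.PFilter.mem_of_le hst hps)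
      exact hp _ (Or.inr ⟨b, hb, rfl⟩) hpb)
  refine ⟨⟨q, hq⟩, ?_⟩
  rintro c (hc | hc)
  · obtain ⟨a, rfl⟩ := h𝒜 hc
    exact hS a ⟨{a}, by simpa using hc, by simp⟩
  · obtain ⟨_, ⟨a, rfl⟩, rfl⟩ := hℬ hc
    exact hT a ⟨{a}, by simpa using hc, by simp⟩

theorem lowerStarData_isDescriptive : A.lowerStarData.IsDescriptive where
  toIsGeneral := A.lowerStarData_isGeneral
  compact := A.lowerStarData_compact
  le_refined p q hpq := by
    obtain ⟨a, hap, haq⟩ := Set.not_subset.mp hpq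
    exact ⟨_, ⟨a, rfl⟩, hap, haq⟩
  rel_refined p q hpq := by
    have : ∃ a b : A, a ⥽ b ∈ p.1 ∧ a ∈ q.1 ∧ b ∉ q.1 := by
      by_contra! hcon
      exact hpq hcon
    obtain ⟨a, b, hab, ha, hb⟩ := this
    exact ⟨_, ⟨a, rfl⟩, _, ⟨b, rfl⟩, A.tilde_sto a b ▸ hab, ha, hb⟩

/-! ### Duals of morphisms and representation of algebras -/

variable {A} {B : HLAlg.{u}}

theorem infClosed_image_pfilter (h : A ⟶ B) (q : A.PrimeFilter) :
    InfClosed (h.toHeytingHom '' {a | a ∈ q.1}) := by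
  rintro _ ⟨a, ha, rfl⟩ _ ⟨b, hb, rfl⟩
  exact ⟨a ⊓ b, Order.PFilter.inf_mem ha hb, map_inf _ _ _⟩

theorem supClosed_image_compl_pfilter (h : A ⟶ B) (q : A.PrimeFilter) :
    SupClosed (h.toHeytingHom '' {a | a ∉ q.1}) := by
  rintro _ ⟨a, ha, rfl⟩ _ ⟨b, hb, rfl⟩
  exact ⟨a ⊔ b, fun hab => (q.2.sup_mem_iff.mp hab).elim ha hb, map_sup _ _ _⟩

/-- Turns the equation `h_*(p) = q` of the back conditions into a separation problem: contain
`h[q]`, avoid `h[A ∖ q]`. -/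
theorem comapPrimeFilter_eq_of_image (h : A ⟶ B) (p : B.PrimeFilter) (q : A.PrimeFilter)
    (hmem : ∀ b ∈ h.toHeytingHom '' {a | a ∈ q.1}, b ∈ p.1)
    (hnot : ∀ b ∈ h.toHeytingHom '' {a | a ∉ q.1}, b ∉ p.1) : comapPrimeFilter h p = q := by
  refine Subtype.ext (SetLike.ext fun a => ⟨fun ha => ?_, fun ha => hmem _ ⟨a, ha, rfl⟩⟩)
  by_contra haq
  exact hnot _ ⟨a, haq, rfl⟩ ha

theorem isMorphism_comapPrimeFilter (h : A ⟶ B) :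
    FrameData.IsMorphism B.lowerStarData A.lowerStarData (comapPrimeFilter h) where
  map_le _ _ hpq _ ha := hpq ha
  exists_le p q hpq := by
    obtain ⟨r, hr, hmem, hnot, hpr⟩ := exists_isPrime_pfilter_himp p.1
      (Set.Nonempty.image _ ⟨⊤, Order.PFilter.top_mem⟩) (infClosed_image_pfilter h q)
      (Set.Nonempty.image _ ⟨⊥, q.2.bot_notMem⟩) (supClosed_image_compl_pfilter h q) (by
        rintro _ ⟨a, ha, rfl⟩ _ ⟨b, hb, rfl⟩ hab
        rw [← map_himp] at hab
        have hab' : a ⇨ b ∈ q.1 := hpq hab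
        exact hb (Order.PFilter.mem_of_le inf_himp_le (Order.PFilter.inf_mem ha hab')))
    exact ⟨⟨r, hr⟩, hpr, comapPrimeFilter_eq_of_image h _ q hmem hnot⟩
  map_rel p q hpq a b hab ha := hpq _ _ (h.map_sto a b ▸ hab) ha
  exists_rel p q hpq := by
    obtain ⟨r, hr, hmem, hnot, hpr⟩ := HeytingLewisAlgebra.exists_isPrime_pfilter_sto p.1
      (Set.Nonempty.image _ ⟨⊤, Order.PFilter.top_mem⟩) (infClosed_image_pfilter h q)
      (Set.Nonempty.image _ ⟨⊥, q.2.bot_notMem⟩) (supClosed_image_compl_pfilter h q) (by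
        rintro _ ⟨a, ha, rfl⟩ _ ⟨b, hb, rfl⟩ hab
        -- An entailment in `p` from `h a` to `h b` is `h (a ⥽ b) ∈ p`, so the `⊏'`-relation from
        -- `h_*(p)` to `q` forces `b ∈ q`.
        rw [← h.map_sto] at hab
        exact hb (hpq a b hab ha))
    exact ⟨⟨r, hr⟩, hpr, comapPrimeFilter_eq_of_image h _ q hmem hnot⟩
  preimage_mem := by
    rintro _ ⟨a, rfl⟩
    exact ⟨h.toHeytingHom a, rfl⟩

/-- A bijective morphism of Heyting-Lewis algebras is an isomorphism. -/
noncomputable def isoOfBijective (h : A ⟶ B) (hh : Function.Bijective h.toHeytingHom) :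
    A ≅ B where
  hom := h
  inv :=
    { toHeytingHom :=
        { toFun := (Equiv.ofBijective _ hh).symm
          map_sup' := fun a b => hh.1 (by simp [Equiv.ofBijective_apply_symm_apply])
          map_inf' := fun a b => hh.1 (by simp [Equiv.ofBijective_apply_symm_apply])
          map_bot' := hh.1 (by simp [Equiv.ofBijective_apply_symm_apply])
          map_himp' := fun a b => hh.1 (by simp [Equiv.ofBijective_apply_symm_apply]) }
      map_sto := fun a b => hh.1 (by
        rw [h.map_sto]
        exact ((Equiv.ofBijective _ hh).apply_symm_apply _).trans (congrArg₂ _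
          ((Equiv.ofBijective _ hh).apply_symm_apply _).symm
          ((Equiv.ofBijective _ hh).apply_symm_apply _).symm)) }
  hom_inv_id := Hom.ext (HeytingHom.ext (Equiv.ofBijective _ hh).symm_apply_apply)
  inv_hom_id := Hom.ext (HeytingHom.ext (Equiv.ofBijective _ hh).apply_symm_apply)

/-- The descriptive frame dual to a Heyting-Lewis algebra. -/
abbrev lowerStarObj (A : HLAlg.{u}) : DFrm.{u} := ⟨A.lowerStarData, A.lowerStarData_isDescriptive⟩

/-- The representation morphism `a ↦ ã`. -/
def tildeHom (A : HLAlg.{u}) : A ⟶ A.lowerStarObj.upperStarObj where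
  toHeytingHom :=
    { toFun := fun a => (⟨A.tilde a, a, rfl⟩ : Set.range A.tilde)
      map_sup' := fun a b => Subtype.ext (A.tilde_sup a b)
      map_inf' := fun a b => Subtype.ext (A.tilde_inf a b)
      map_bot' := Subtype.ext A.tilde_bot
      map_himp' := fun a b => Subtype.ext (A.tilde_himp a b) }
  map_sto a b := Subtype.ext (A.tilde_sto a b)

theorem tildeHom_bijective (A : HLAlg.{u}) : Function.Bijective A.tildeHom.toHeytingHom :=
  ⟨fun _ _ h => A.tilde_injective (congrArg Subtype.val h),
    fun ⟨_, a, ha⟩ => ⟨a, Subtype.ext ha⟩⟩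

end HLAlg

/-! ### Representation of descriptive frames -/

namespace DFrm

variable {F G : DFrm.{u}}

/-- A bijection that preserves and reflects both relations and the admissible sets is an
isomorphism of descriptive frames. -/
noncomputable def isoOfBijective (f : F ⟶ G) (hf : Function.Bijective f.toFun)
    (hle : ∀ x y, f.toFun x ≤ f.toFun y → x ≤ y)
    (hrel : ∀ x y, G.data.rel (f.toFun x) (f.toFun y) → F.data.rel x y)
    (hadm : ∀ a ∈ F.data.admissible, ∃ b ∈ G.data.admissible, a = f.toFun ⁻¹' b) : F ≅ G where
  hom := f
  inv :=
    { toFun := (Equiv.ofBijective _ hf).symm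
      isMorphism :=
        { map_le := fun x y h => by
            obtain ⟨x, rfl⟩ := hf.2 x
            obtain ⟨y, rfl⟩ := hf.2 y
            rw [Equiv.ofBijective_symm_apply_apply, Equiv.ofBijective_symm_apply_apply]
            exact hle x y h
          -- The back condition for the inverse is the forth condition for `f`; likewise for the
          -- other relation.
          exists_le := fun x z h => by
            obtain ⟨x, rfl⟩ := hf.2 x
            rw [Equiv.ofBijective_symm_apply_apply] at h
            exact ⟨_, f.isMorphism.map_le _ _ h, Equiv.ofBijective_symm_apply_apply _ hf z⟩
          map_rel := fun x y h => by
            obtain ⟨x, rfl⟩ := hf.2 x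
            obtain ⟨y, rfl⟩ := hf.2 y
            rw [Equiv.ofBijective_symm_apply_apply, Equiv.ofBijective_symm_apply_apply]
            exact hrel x y h
          exists_rel := fun x z h => by
            obtain ⟨x, rfl⟩ := hf.2 x
            rw [Equiv.ofBijective_symm_apply_apply] at h
            exact ⟨_, f.isMorphism.map_rel _ _ h, Equiv.ofBijective_symm_apply_apply _ hf z⟩
          preimage_mem := fun a ha => by
            obtain ⟨b, hb, rfl⟩ := hadm a ha
            rw [← Set.preimage_comp]
            have hcomp : f.toFun ∘ (Equiv.ofBijective _ hf).symm = id :=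
              funext (Equiv.ofBijective_apply_symm_apply _ hf)
            rwa [hcomp] } }
  hom_inv_id := Hom.ext (funext (Equiv.ofBijective _ hf).symm_apply_apply)
  inv_hom_id := Hom.ext (funext (Equiv.ofBijective _ hf).apply_symm_apply)

variable (F)

/-- The prime filter of the admissible sets that contain a state. -/
def pointFilter (x : F.data) : F.upperStarObj.PrimeFilter :=
  ⟨Order.IsPFilter.toPFilter (P := F.upperStarObj)
      (F := {a : F.upperStarObj | x ∈ (a : F.data.admissible).1}) <| .of_def
      ⟨(⊤ : F.upperStarObj), Set.mem_univ x⟩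
      (fun a ha b hb => ⟨a ⊓ b, ⟨ha, hb⟩, inf_le_left, inf_le_right⟩)
      (fun hab ha => hab ha),
    ⟨⟨fun _ _ hba ha hb => ha (hba hb), ⟨(⊥ : F.upperStarObj), Set.notMem_empty x⟩,
      fun a ha b hb => ⟨a ⊔ b, fun hab => Or.elim hab ha hb, le_sup_left, le_sup_right⟩⟩⟩⟩

theorem pointFilter_le_iff {x y : F.data} : F.pointFilter x ≤ F.pointFilter y ↔ x ≤ y := by
  refine ⟨fun h => ?_, fun h a ha => F.isDescriptive.isUpperSet _ a.2 h ha⟩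
  by_contra hxy
  obtain ⟨a, ha, hxa, hya⟩ := F.isDescriptive.le_refined x y hxy
  exact hya (h (show (⟨a, ha⟩ : F.data.admissible) ∈ (F.pointFilter x).1 from hxa))

theorem rel_pointFilter_iff {x y : F.data} :
    F.upperStarObj.lowerStarData.rel (F.pointFilter x) (F.pointFilter y) ↔ F.data.rel x y := by
  refine ⟨fun h => ?_, fun h a b hab ha => hab y h ha⟩
  by_contra hxy
  obtain ⟨a, ha, b, hb, hab, hya, hyb⟩ := F.isDescriptive.rel_refined x y hxy
  exact hyb (h (⟨a, ha⟩ : F.data.admissible) (⟨b, hb⟩ : F.data.admissible) hab hya)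

theorem pointFilter_injective : Function.Injective F.pointFilter := fun _ _ h =>
  le_antisymm (F.pointFilter_le_iff.mp h.le) (F.pointFilter_le_iff.mp h.ge)

/-- Apply compactness to the members of `p` together with the complements of the non-members. A
finite subfamily has an intersection containing `a ∖ b` for some `a ∈ p` and `b ∉ p`, and this is
nonempty because `a ⊆ b` would force `b ∈ p`. A common point `x` has `p` as its filter. -/
theorem pointFilter_surjective : Function.Surjective F.pointFilter := by
  intro p
  have hinf (s : Set (Set F.data)) (hs : s.Finite)
      (hsp : ∀ c ∈ s, ∃ a : F.upperStarObj, a ∈ p.1 ∧ c = (a : F.data.admissible).1) :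
      ∃ a : F.upperStarObj, a ∈ p.1 ∧ (a : F.data.admissible).1 ⊆ ⋂₀ s := by
    induction s, hs using Set.Finite.induction_on with
    | empty => exact ⟨⊤, Order.PFilter.top_mem, by simp⟩
    | @insert c s _ _ ih =>
      obtain ⟨a, ha, has⟩ := ih fun c hc => hsp c (Or.inr hc)
      obtain ⟨b, hb, rfl⟩ := hsp c (Or.inl rfl)
      refine ⟨b ⊓ a, Order.PFilter.inf_mem hb ha, ?_⟩
      rw [Set.sInter_insert]
      exact Set.inter_subset_inter_right _ has
  have hsup (s : Set (Set F.data)) (hs : s.Finite)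
      (hsp : ∀ c ∈ s, ∃ a : F.upperStarObj, a ∉ p.1 ∧ c = (a : F.data.admissible).1ᶜ) :
      ∃ a : F.upperStarObj, a ∉ p.1 ∧ (a : F.data.admissible).1ᶜ ⊆ ⋂₀ s := by
    induction s, hs using Set.Finite.induction_on with
    | empty => exact ⟨⊥, p.2.bot_notMem, by simp⟩
    | @insert c s _ _ ih =>
      obtain ⟨a, ha, has⟩ := ih fun c hc => hsp c (Or.inr hc)
      obtain ⟨b, hb, rfl⟩ := hsp c (Or.inl rfl)
      refine ⟨b ⊔ a, fun h => (p.2.sup_mem_iff.mp h).elim hb ha, ?_⟩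
      rw [Set.sInter_insert]
      exact fun x hx => ⟨fun h => hx (Or.inl h), has fun h => hx (Or.inr h)⟩
  obtain ⟨x, hx⟩ := F.isDescriptive.compact
    {c | ∃ a : F.upperStarObj, a ∈ p.1 ∧ c = (a : F.data.admissible).1}
    (by rintro _ ⟨a, -, rfl⟩; exact a.2)
    {c | ∃ a : F.upperStarObj, a ∉ p.1 ∧ c = (a : F.data.admissible).1ᶜ}
    (by rintro _ ⟨a, -, rfl⟩; exact ⟨_, a.2, rfl⟩)
    (by
      intro 𝒮 h𝒮 hfin
      obtain ⟨a, ha, ha'⟩ := hinf {c ∈ 𝒮 | ∃ a : F.upperStarObj, a ∈ p.1 ∧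
        c = (a : F.data.admissible).1} (hfin.subset (Set.sep_subset _ _)) fun _ h => h.2
      obtain ⟨b, hb, hb'⟩ := hsup {c ∈ 𝒮 | ∃ a : F.upperStarObj, a ∉ p.1 ∧
        c = (a : F.data.admissible).1ᶜ} (hfin.subset (Set.sep_subset _ _)) fun _ h => h.2
      obtain ⟨x, hxa, hxb⟩ := Set.not_subset.mp fun hab : (a : F.data.admissible).1 ⊆
        (b : F.data.admissible).1 => hb (Order.PFilter.mem_of_le (show a ≤ b from hab) ha)
      exact ⟨x, fun c hc => (h𝒮 hc).elim (fun h => ha' hxa c ⟨hc, h⟩)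
        fun h => hb' hxb c ⟨hc, h⟩⟩)
  refine ⟨x, Subtype.ext (SetLike.ext fun a => ⟨fun ha => ?_, fun ha => ?_⟩)⟩
  · by_contra hap
    exact hx _ (Or.inr ⟨a, hap, rfl⟩) ha
  · exact hx _ (Or.inl ⟨a, ha, rfl⟩)

/-- The map of a descriptive frame into its double dual. -/
def pointHom : F ⟶ F.upperStarObj.lowerStarObj where
  toFun := F.pointFilter
  isMorphism :=
    { map_le := fun _ _ => F.pointFilter_le_iff.mpr
      exists_le := fun x p h => by
        obtain ⟨y, rfl⟩ := F.pointFilter_surjective p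
        exact ⟨y, F.pointFilter_le_iff.mp h, rfl⟩
      map_rel := fun _ _ => F.rel_pointFilter_iff.mpr
      exists_rel := fun x p h => by
        obtain ⟨y, rfl⟩ := F.pointFilter_surjective p
        exact ⟨y, F.rel_pointFilter_iff.mp h, rfl⟩
      preimage_mem := by
        rintro _ ⟨a, rfl⟩
        exact a.2 }

/-- A descriptive frame is isomorphic to its double dual. -/
noncomputable def pointIso : F ≅ F.upperStarObj.lowerStarObj :=
  isoOfBijective F.pointHom ⟨F.pointFilter_injective, F.pointFilter_surjective⟩
    (fun _ _ => F.pointFilter_le_iff.mp) (fun _ _ => F.rel_pointFilter_iff.mp)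
    fun a ha => ⟨_, ⟨(⟨a, ha⟩ : F.data.admissible), rfl⟩, rfl⟩

end DFrm

/-! ### The dual equivalence -/

/-- The dual equivalence between Heyting-Lewis algebras and descriptive frames. -/
noncomputable def starEquivalence : HLAlg.{u} ≌ DFrm.{u}ᵒᵖ :=
  -- `Equivalence.mk` adjusts the unit to satisfy the triangle identity and leaves both functors
  -- unchanged, so two natural isomorphisms suffice.
  CategoryTheory.Equivalence.mk
    (lowerStar HLAlg.lowerStarData_isDescriptive fun _ _ => HLAlg.isMorphism_comapPrimeFilter)
    upperStar
    (NatIso.ofComponents (fun A => HLAlg.isoOfBijective A.tildeHom A.tildeHom_bijective)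
      fun _ => rfl)
    (NatIso.ofComponents (fun F => F.unop.pointIso.op) fun _ => rfl)

theorem mainTheorem1 :
    (∀ (A : HLAlg.{u}) (a b : A),
      A.tilde (a ⥽ b) = A.lowerStarData.stoSet (A.tilde a) (A.tilde b)) ∧
    ∃ (hobj : ∀ A : HLAlg.{u}, A.lowerStarData.IsDescriptive)
      (hmap : ∀ (A B : HLAlg.{u}) (h : A ⟶ B),
        FrameData.IsMorphism B.lowerStarData A.lowerStarData (HLAlg.comapPrimeFilter h))
      (e : HLAlg.{u} ≌ DFrm.{u}ᵒᵖ),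
      e.functor = lowerStar hobj hmap ∧ e.inverse = upperStar :=
  ⟨HLAlg.tilde_sto, HLAlg.lowerStarData_isDescriptive,
    fun _ _ => HLAlg.isMorphism_comapPrimeFilter, starEquivalence, rfl, rfl⟩
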